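/- Let $M$ be a connected orientable 3-manifold with boundary a single torus, and let $\mathcal T$ be an (oriented) ideal triangulation of $M$ with $N$ tetrahedra. Write $z^{(t)}_1,z^{(t)}_2,z^{(t)}_3$ for the three complex dihedral angles of tetrahedron $t$ (each belonging to a pair of opposite edges, cyclically ordered by the orientation). The deformation variety $\mathfrak D(M;\mathcal T)\subset(\mathbb C\setminus\{0,1\})^{3N}$ is the set of solutions of $z^{(t)}_1z^{(t)}_2z^{(t)}_3=-1$, $1-z^{(t)}_1+z^{(t)}_1z^{(t)}_2=0$ for all $t$, together with the gluing equations: for every edge of $\mathcal T$, the product of the dihedral angles around it is $1$. An ideal point of $\mathfrak D(M;\mathcal T)$ is a limit point on the unit sphere $S^{3N-1}$ of the set of all $$\Lambda(z)=\frac{(\log|z^{(1)}_1|,\log|z^{(1)}_2|,\dots,\log|z^{(N)}_3|)}{\sqrt{1+\sum_{t,i}(\log|z^{(t)}_i|)^2}},\qquad z\in\mathfrak D(M;\mathcal T)$$ (Bergman's logarithmic limit set). Fix a labelling of $\mathcal T$ (a choice of one of the three angles of each tetrahedron) and a proposed degeneration: each tetrahedron is either declared non-degenerating, or is given an integer rate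 $k_t\ge 1$ and a type, namely which of its angles is to converge to $0$; the other two, in cyclic order, are then to converge to $\infty$ and $1$. At least one tetrahedron is proposed to degenerate. Take a variable $\zeta$ and one variable $y_t$ for each tetrahedron, called an angle variable if $t$ does not degenerate and a direction variable if it does. Put $Z_t=y_t$ if $t$ does not degenerate, and $Z_t=\zeta^{k_t}y_t$ if it does; substitute $Z_t,\ \frac{Z_t-1}{Z_t},\ \frac1{1-Z_t}$ (in cyclic order) for the three angles of $t$, where $Z_t$ stands for the labelled angle if $t$ does not degenerate and for the angle that is to converge to $0$ if it does. The tilde equation of an edge is obtained from its gluing equation by this substitution, multiplying up by denominators to get a polynomial equation $P=0$, and dividing $P$ by the largest power of $\zeta$ that divides it. A normalising equation is one further polynomial equation $F(\zeta,y_1,\dots,y_N)=0$ with complex coefficients. Suppose that the tilde equations of all edges together with a normalising equation have a solution $\tilde p\in\mathbb C^{N+1}$ with $\zeta=0$, with all angle variables different from $0$ and $1$ and all direction variables non-zero, and that $\tilde p$ is an isolated point of the set of those solutions of these equations for which $\zeta=0$. Then $\tilde p$ corresponds to an ideal point of $\mathfrak D(M;\mathcal T)$, in the following sense. Let $v\in\mathbb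 R^{3N}$ be the vector whose entries for a degenerating tetrahedron $t$ are $-k_t,k_t,0$ at the angles that are to converge to $0,\infty,1$ respectively, and whose entries for a non-degenerating tetrahedron are $0$. Then $\bar p=v/\|v\|$ is an ideal point of $\mathfrak D(M;\mathcal T)$, and there is a sequence of solutions $\tilde q_n$ of the tilde equations and the normalising equation with $\zeta\neq0$ and $\tilde q_n\to\tilde p$, such that the dihedral angles given by $\tilde q_n$ form a point $q_n$ of $\mathfrak D(M;\mathcal T)$ and $\Lambda(q_n)\to\bar p$. -/

import Mathlib

open Filter Topology

noncomputable section

/-! Oriented ideal triangulations -/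

/-- `N` oriented tetrahedra, each with vertices `0, 1, 2, 3`, all of whose faces are glued in pairs.
Face `f` is the face opposite to vertex `f`.  Face `f` of tetrahedron `t` is glued to face
`glue t f f` of tetrahedron `adj t f`, and the vertex `v ≠ f` of that face goes to `glue t f v`.
The gluing maps reverse the orientation of faces, so that the result is oriented. -/
structure IdealTriangulation (N : ℕ) where
  adj : Fin N → Fin 4 → Fin N
  glue : Fin N → Fin 4 → Equiv.Perm (Fin 4)
  adj_adj : ∀ t f, adj (adj t f) (glue t f f) = t
  glue_glue : ∀ t f, glue (adj t f) (glue t f f) = (glue t f)⁻¹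
  odd : ∀ t f, Equiv.Perm.sign (glue t f) = -1
  free : ∀ t f, (adj t f, glue t f f) ≠ (t, f)

/-- A tetrahedron `x.1.1` together with an ordered pair of distinct vertices `x.1.2.1`, `x.1.2.2`.
It is read as a directed edge of the tetrahedron, or (as the end of that edge at `x.1.2.1`) as a
corner of the triangle that cuts off the vertex `x.1.2.1`, or as the side of that triangle that
lies in the face opposite to `x.1.2.2`. -/
abbrev VertexPair (N : ℕ) : Type := {x : Fin N × Fin 4 × Fin 4 // x.2.1 ≠ x.2.2}

namespace IdealTriangulation

variable {N : ℕ} (T : IdealTriangulation N)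

/-- Vertices of tetrahedra, identified through the face gluings. -/
def vertexSetoid : Setoid (Fin N × Fin 4) :=
  Relation.EqvGen.setoid fun x y =>
    ∃ f, f ≠ x.2 ∧ y = (T.adj x.1 f, T.glue x.1 f x.2)

/-- Ideal vertices of the triangulation. -/
abbrev IdealVertex : Type := Quotient T.vertexSetoid

/-- One face gluing identifies the directed edges `x` and `y`. -/
def EdgeStep (x y : VertexPair N) : Prop :=
  ∃ f, f ≠ x.1.2.1 ∧ f ≠ x.1.2.2 ∧
    y.1 = (T.adj x.1.1 f, T.glue x.1.1 f x.1.2.1, T.glue x.1.1 f x.1.2.2)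

/-- Directed edges of tetrahedra, identified through the face gluings. -/
def directedEdgeSetoid : Setoid (VertexPair N) :=
  Relation.EqvGen.setoid T.EdgeStep

/-- Undirected edges of tetrahedra, identified through the face gluings. -/
def edgeSetoid : Setoid (VertexPair N) :=
  Relation.EqvGen.setoid fun x y =>
    T.EdgeStep x y ∨ y.1 = (x.1.1, x.1.2.2, x.1.2.1)

/-- Edges of the triangulation. -/
abbrev Edge : Type := Quotient T.edgeSetoid

/-- The triangles that cut off the vertices of the tetrahedra have sides, the side of the triangle
at `v` in the face `f` being written as the pair `(v, f)`; these sides are glued in pairs. -/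
def linkSideSetoid : Setoid (VertexPair N) :=
  Relation.EqvGen.setoid fun x y =>
    y.1 = (T.adj x.1.1 x.1.2.2, T.glue x.1.1 x.1.2.2 x.1.2.1, T.glue x.1.1 x.1.2.2 x.1.2.2)

/-- The ideal vertex from which `x` emanates. -/
def startVertex (x : VertexPair N) : T.IdealVertex :=
  Quotient.mk T.vertexSetoid (x.1.1, x.1.2.1)

/-- Euler characteristic (vertices minus sides plus triangles) of the link of an ideal vertex.  This
link is the closed, connected, oriented surface that is glued from the triangles cutting off the
vertices in the class `c`; its vertices are the ends at `c` of the edges of the triangulation. -/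
def linkEulerChar (c : T.IdealVertex) : ℤ :=
  (((Quotient.mk T.directedEdgeSetoid) '' {x | T.startVertex x = c}).ncard : ℤ)
    - (((Quotient.mk T.linkSideSetoid) '' {x | T.startVertex x = c}).ncard : ℤ)
    + ({x : Fin N × Fin 4 | Quotient.mk T.vertexSetoid x = c}.ncard : ℤ)

/-- There is exactly one ideal vertex, and its link is a torus: the triangulated manifold (with an
open neighbourhood of the ideal vertex removed) has boundary a single torus. -/
def HasTorusBoundary : Prop :=
  ∃ c : T.IdealVertex, (∀ d : T.IdealVertex, d = c) ∧ T.linkEulerChar c = 0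

/-- The dihedral angles at opposite edges of a tetrahedron agree.  The three pairs of opposite edges
are numbered `0, 1, 2`, in the same cyclic order around each vertex with respect to the orientation
of the tetrahedron. -/
def dihedralIndex (v w : Fin 4) : Fin 3 :=
  if s(v, w) = s(0, 1) ∨ s(v, w) = s(2, 3) then 0
  else if s(v, w) = s(0, 2) ∨ s(v, w) = s(1, 3) then 1
  else 2

open Classical in
/-- The undirected edges of tetrahedra that make up the edge `e`, each listed once. -/
def edgeMembers (e : T.Edge) : Finset (VertexPair N) :=
  Finset.univ.filter fun x => x.1.2.1 < x.1.2.2 ∧ Quotient.mk T.edgeSetoid x = e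

/-- The deformation variety: the points `z` of `(ℂ ∖ {0, 1}) ^ (3N)`, where `z t i` is the complex
dihedral angle of tetrahedron `t` at its `i`-th pair of opposite edges, which satisfy the identities
in each tetrahedron and the gluing equation at each edge. -/
def deformationVariety : Set (Fin N → Fin 3 → ℂ) :=
  {z | (∀ t i, z t i ≠ 0 ∧ z t i ≠ 1) ∧
    (∀ t, z t 0 * z t 1 * z t 2 = -1 ∧ 1 - z t 0 + z t 0 * z t 1 = 0) ∧
    ∀ e : T.Edge, ∏ x ∈ T.edgeMembers e, z x.1.1 (dihedralIndex x.1.2.1 x.1.2.2) = 1}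

end IdealTriangulation

/-! Ideal points -/

/-- `(log |z t i|) / √(1 + ∑ (log |z t i|)²)`, a point of the open unit ball in `ℝ^(3N)`. -/
def logPoint {N : ℕ} (z : Fin N → Fin 3 → ℂ) : EuclideanSpace ℝ (Fin N × Fin 3) :=
  WithLp.toLp 2 fun x =>
    Real.log ‖z x.1 x.2‖ / Real.sqrt (1 + ∑ y : Fin N × Fin 3, Real.log ‖z y.1 y.2‖ ^ 2)

/-- Points of the logarithmic limit set of the deformation variety: limit points on the unit
sphere of its image in the unit ball. -/
def IsIdealPoint {N : ℕ} (T : IdealTriangulation N) (b : EuclideanSpace ℝ (Fin N × Fin 3)) : Prop :=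
  b ∈ Metric.sphere (0 : EuclideanSpace ℝ (Fin N × Fin 3)) 1 ∧
    AccPt b (𝓟 (logPoint '' T.deformationVariety))

/-! Proposed degenerations and the tilde equations -/

/-- Degeneration types and rates: `D t = none` if tetrahedron `t` is not supposed to degenerate, and
`D t = some (i, k)` if its angles number `i, i + 1, i + 2` (modulo 3) are supposed to converge to
`0, ∞, 1`, at the rate `k ≥ 1`. -/
abbrev Degeneration (N : ℕ) : Type := Fin N → Option (Fin 3 × ℕ+)

namespace Degeneration

open MvPolynomial

variable {N : ℕ} (D : Degeneration N) (l : Fin N → Fin 3)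

/-- The angle of tetrahedron `t` whose variable is used: the one converging to `0` if `t`
degenerates, the labelled one otherwise. -/
def baseAngle (t : Fin N) : Fin 3 :=
  match D t with
  | none => l t
  | some (i, _) => i

/-- The base angle of `t` as a polynomial in the variables `ζ = X none` and `X (some t)`: the angle
variable of `t` itself, or `ζ ^ k` times the direction variable of `t`. -/
def baseValue (t : Fin N) : MvPolynomial (Option (Fin N)) ℂ :=
  match D t with
  | none => X (some t)
  | some (_, k) => X none ^ (k : ℕ) * X (some t)

/-- Numerator of the `j`-th angle of `t`; with `Z` the base angle, the three angles are
`Z / 1`, `(Z - 1) / Z` and `1 / (1 - Z)`. -/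
def angleNum (t : Fin N) (j : Fin 3) : MvPolynomial (Option (Fin N)) ℂ :=
  if j = D.baseAngle l t then D.baseValue t
  else if j = D.baseAngle l t + 1 then D.baseValue t - 1
  else 1

/-- Denominator of the `j`-th angle of `t`. -/
def angleDen (t : Fin N) (j : Fin 3) : MvPolynomial (Option (Fin N)) ℂ :=
  if j = D.baseAngle l t then 1
  else if j = D.baseAngle l t + 1 then D.baseValue t
  else 1 - D.baseValue t

/-- The complex dihedral angles given by values `q` of `ζ` and of the angle and direction
variables. -/
def angles (q : Option (Fin N) → ℂ) (t : Fin N) (j : Fin 3) : ℂ :=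
  eval q (D.angleNum l t j) / eval q (D.angleDen l t j)

/-- The gluing equation at `e` in the new variables, multiplied up by denominators. -/
def gluingPoly (T : IdealTriangulation N) (e : T.Edge) : MvPolynomial (Option (Fin N)) ℂ :=
  ∏ x ∈ T.edgeMembers e, D.angleNum l x.1.1 (IdealTriangulation.dihedralIndex x.1.2.1 x.1.2.2) -
  ∏ x ∈ T.edgeMembers e, D.angleDen l x.1.1 (IdealTriangulation.dihedralIndex x.1.2.1 x.1.2.2)

/-- Divide a polynomial by the largest power of `ζ` that divides it (`0` is left unchanged). -/
def removeZeta (P : MvPolynomial (Option (Fin N)) ℂ) : MvPolynomial (Option (Fin N)) ℂ :=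
  P.divMonomial (Finsupp.single none (multiplicity (X none) P))

theorem pow_mul_removeZeta (P : MvPolynomial (Option (Fin N)) ℂ) :
    X none ^ multiplicity (X none) P * removeZeta P = P := by
  obtain ⟨Q, hQ⟩ := pow_multiplicity_dvd (X none : MvPolynomial (Option (Fin N)) ℂ) P
  have h : removeZeta P = Q := by
    unfold removeZeta
    generalize multiplicity (X none) P = m at *
    rw [hQ, X_pow_eq_monomial, divMonomial_monomial_mul]
  rw [h, ← hQ]

theorem not_dvd_removeZeta {P : MvPolynomial (Option (Fin N)) ℂ} (hP : P ≠ 0) :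
    ¬ X none ∣ removeZeta P := by
  rintro ⟨Q, hQ⟩
  have hfin : FiniteMultiplicity (X none : MvPolynomial (Option (Fin N)) ℂ) P :=
    FiniteMultiplicity.of_prime_left X_prime hP
  refine hfin.not_pow_dvd_of_multiplicity_lt (Nat.lt_succ_self _) ⟨Q, ?_⟩
  conv_lhs => rw [← pow_mul_removeZeta P, hQ]
  rw [pow_succ, mul_assoc]

/-- The polynomial on the left hand side of the tilde equation `… = 0` at the edge `e`. -/
def tildePoly (T : IdealTriangulation N) (e : T.Edge) : MvPolynomial (Option (Fin N)) ℂ :=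
  removeZeta (D.gluingPoly l T e)

/-- Common solutions of all tilde equations and of the additional polynomial equation `F = 0`. -/
def tildeVariety (T : IdealTriangulation N) (F : MvPolynomial (Option (Fin N)) ℂ) :
    Set (Option (Fin N) → ℂ) :=
  {q | (∀ e : T.Edge, eval q (D.tildePoly l T e) = 0) ∧ eval q F = 0}

/-- All angle variables are different from `0` and `1`, and all direction variables are non-zero. -/
def Nondegenerate (q : Option (Fin N) → ℂ) : Prop :=
  ∀ t, q (some t) ≠ 0 ∧ (D t = none → q (some t) ≠ 1)

/-- The rates at which the logarithms of the absolute values of the angles are supposed to tend to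
infinity, with signs: `-k, k, 0` for angles converging to `0, ∞, 1` at the rate `k`, and `0` for the
angles of a tetrahedron that does not degenerate. -/
def rateVector : EuclideanSpace ℝ (Fin N × Fin 3) :=
  WithLp.toLp 2 fun x =>
    match D x.1 with
    | none => 0
    | some (i, k) => if x.2 = i then -(k : ℝ) else if x.2 = i + 1 then (k : ℝ) else 0

end Degeneration

/-- `p` is an isolated point of `S`. -/
def IsIsolatedPointOf {X : Type*} [TopologicalSpace X] (p : X) (S : Set X) : Prop :=
  p ∈ S ∧ ∃ U ∈ 𝓝 p, ∀ q ∈ U, q ∈ S → q = p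

end

noncomputable section

/-! Points of affine varieties -/

/-! Near `p` the tilde variety is cut out by at most `N` equations in `N + 1` unknowns. The link of
the only ideal vertex has Euler characteristic 0, so there are at most `N` edges
(`HasTorusBoundary.card_edge_le`). One tilde equation is redundant near `p`: every angle sits at two
edges of its tetrahedron and the three angles multiply to -1, so over all edges together the
numerators and the denominators have the same product (`exists_tildePoly_mul_mem_span`). This makes
room for `F`.

By Krull's height theorem some component through `p` has positive dimension. As `p` is isolated in
the slice `ζ = 0`, this component does not lie in that slice. Points off a proper subvariety are
dense in an irreducible variety in the Euclidean topology
(`MvPolynomial.exists_mem_nhds_eval_ne_zero`, by Noether normalisation), so solutions with `ζ ≠ 0`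
converge to `p`.

Such solutions, close enough to `p`, give points of the deformation variety. Since `log |Z_t| = k_t
log |ζ| + O(1)` for degenerating `t`, dividing the logarithms by `-log |ζ|` yields the rate vector
in the limit. -/

theorem Multiset.pow_card_le_norm_prod {r : ℝ} (hr : 0 ≤ r) (s : Multiset ℂ)
    (h : ∀ x ∈ s, r ≤ ‖x‖) : r ^ card s ≤ ‖s.prod‖ := by
  induction s using Multiset.induction_on with
  | empty => simp
  | cons a s ih =>
    rw [card_cons, prod_cons, norm_mul, pow_succ']
    exact mul_le_mul (h a (mem_cons_self a s)) (ih fun x hx => h x (mem_cons_of_mem hx))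
      (pow_nonneg hr _) (norm_nonneg a)

/-- The constant coefficient is, up to sign, the product of the roots; take the smallest root. -/
theorem Polynomial.Monic.exists_isRoot_norm_pow_le {P : Polynomial ℂ} (hP : P.Monic)
    (hd : 0 < P.natDegree) : ∃ μ, P.IsRoot μ ∧ ‖μ‖ ^ P.natDegree ≤ ‖P.coeff 0‖ := by
  have hs := IsAlgClosed.splits P
  obtain ⟨x, hx⟩ := IsAlgClosed.exists_root P (Polynomial.degree_ne_of_natDegree_ne hd.ne')
  obtain ⟨μ, hμ, hmin⟩ := P.roots.toFinset.exists_min_image (fun x => ‖x‖)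
    ⟨x, Multiset.mem_toFinset.2 ((Polynomial.mem_roots hP.ne_zero).2 hx)⟩
  rw [Multiset.mem_toFinset, Polynomial.mem_roots hP.ne_zero] at hμ
  refine ⟨μ, hμ, ?_⟩
  rw [hs.coeff_zero_eq_prod_roots_of_monic hP, norm_mul, norm_pow, norm_neg, norm_one, one_pow,
    one_mul, hs.natDegree_eq_card_roots]
  exact Multiset.pow_card_le_norm_prod (norm_nonneg μ) _ fun y hy =>
    hmin y (Multiset.mem_toFinset.2 hy)

/-- Cauchy's bound, with a sum in place of a maximum so that its limit along converging coefficients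
is immediate. -/
theorem Polynomial.Monic.norm_le_of_isRoot {P : Polynomial ℂ} (hP : P.Monic) {x : ℂ}
    (hx : P.IsRoot x) : ‖x‖ ≤ (∑ i ∈ Finset.range P.natDegree, ‖P.coeff i‖) + 1 := by
  have h := (Polynomial.IsRoot.norm_lt_cauchyBound hP.ne_zero hx).le
  rw [Polynomial.cauchyBound, hP.leadingCoeff, nnnorm_one, div_one] at h
  have : ((Finset.range P.natDegree).sup fun x => ‖P.coeff x‖₊) ≤
      ∑ i ∈ Finset.range P.natDegree, ‖P.coeff i‖₊ :=
    Finset.sup_le fun i hi => Finset.single_le_sum (f := fun i => ‖P.coeff i‖₊)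
      (fun _ _ => zero_le) hi
  simpa using NNReal.coe_le_coe.2 (h.trans (add_le_add_left this 1))

/-- A root, in a field, of the minimal polynomial of `u` over an integrally closed domain is the
value of `u` at a maximal ideal. -/
theorem exists_isMaximal_of_eval₂_minpoly_eq_zero {S A K : Type*} [CommRing S] [IsDomain S]
    [IsIntegrallyClosed S] [CommRing A] [IsDomain A] [Algebra S A] [Module.IsTorsionFree S A]
    [Algebra.IsIntegral S A] [Field K] (u : A) (f : S →+* K) (hf : Function.Surjective f) (μ : K)
    (h : (minpoly S u).eval₂ f μ = 0) :
    ∃ Q : Ideal A, Q.IsMaximal ∧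
      ∀ G : Polynomial S, G.eval₂ f μ = 0 → Polynomial.aeval u G ∈ Q := by
  let φ : Polynomial S →+* A := (Polynomial.aeval u).toRingHom
  let : Algebra (Polynomial S) A := φ.toAlgebra
  have : IsScalarTower S (Polynomial S) A := IsScalarTower.of_algebraMap_eq fun s => by
    simp [RingHom.algebraMap_toAlgebra, φ]
  have : Algebra.IsIntegral (Polynomial S) A :=
    ⟨fun x => (Algebra.IsIntegral.isIntegral (R := S) x).tower_top⟩
  let ev : Polynomial S →+* K := Polynomial.eval₂RingHom f μ
  have hev : Function.Surjective ev := fun k => by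
    obtain ⟨s, rfl⟩ := hf k
    exact ⟨Polynomial.C s, by simp [ev]⟩
  have := RingHom.ker_isMaximal_of_surjective ev hev
  -- Lying over needs the kernel of `S[X] → A` inside that of evaluation at `μ`. As `S` is
  -- integrally closed, the minimal polynomial divides every polynomial that kills `u`.
  obtain ⟨Q, hQ, hQe⟩ := Ideal.exists_ideal_over_maximal_of_isIntegral (S := A) (RingHom.ker ev) (by
    intro G hG
    have hG' : Polynomial.aeval u G = 0 := hG
    obtain ⟨H, rfl⟩ := minpoly.isIntegrallyClosed_dvd (Algebra.IsIntegral.isIntegral u) hG'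
    simp [ev, h, RingHom.mem_ker])
  refine ⟨Q, hQ, fun G hG => ?_⟩
  have : G ∈ Q.comap (algebraMap (Polynomial S) A) := hQe ▸ hG
  exact this

/-- A polynomial that vanishes on a product of balls, which are infinite sets, is zero. -/
theorem MvPolynomial.exists_seq_tendsto_eval_ne_zero {σ : Type*} {h : MvPolynomial σ ℂ} (hh : h ≠ 0)
    (a : σ → ℂ) : ∃ b : ℕ → σ → ℂ, Tendsto b atTop (𝓝 a) ∧ ∀ n, eval (b n) h ≠ 0 := by
  have key : ∀ n : ℕ, ∃ b : σ → ℂ, (∀ i, b i ∈ Metric.ball (a i) (1 / ((n : ℝ) + 1))) ∧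
      eval b h ≠ 0 := by
    intro n
    by_contra! hn
    refine hh (MvPolynomial.funext_set (fun i => Metric.ball (a i) (1 / ((n : ℝ) + 1)))
      (fun i => ?_) fun x hx => ?_)
    · exact infinite_of_mem_nhds (a i) (Metric.ball_mem_nhds _ Nat.one_div_pos_of_nat)
    · simpa using hn x fun i => hx i (Set.mem_univ i)
  choose b hb hb' using key
  refine ⟨b, tendsto_pi_nhds.2 fun i => ?_, hb'⟩
  rw [tendsto_iff_dist_tendsto_zero]
  exact squeeze_zero (fun _ => dist_nonneg) (fun n => (Metric.mem_ball.1 (hb n i)).le)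
    tendsto_one_div_add_atTop_nhds_zero_nat

/-- A polynomial vanishing at `p` and at no point of the finite set `E`, `p` excepted. -/
theorem MvPolynomial.exists_eval_eq_zero_iff {σ : Type*} (p : σ → ℂ) {E : Set (σ → ℂ)}
    (hE : E.Finite) : ∃ u : MvPolynomial σ ℂ, eval p u = 0 ∧ ∀ q ∈ E, eval q u = 0 → q = p := by
  classical
  have key : ∀ q : σ → ℂ, ∃ v : MvPolynomial σ ℂ, eval p v = 1 ∧ (q ≠ p → eval q v = 0) := by
    intro q
    by_cases hq : q = p
    · exact ⟨1, by simp [hq]⟩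
    · obtain ⟨i, hi⟩ := Function.ne_iff.1 hq
      have hi' : p i - q i ≠ 0 := sub_ne_zero.2 (Ne.symm hi)
      exact ⟨C (p i - q i)⁻¹ * (X i - C (q i)), by simp [hi'], by simp⟩
  choose v hv hv' using key
  refine ⟨1 - ∏ q ∈ hE.toFinset, v q, by simp [map_prod, hv], fun q hq h => ?_⟩
  by_contra hne
  rw [map_sub, map_one, map_prod, Finset.prod_eq_zero (hE.mem_toFinset.2 hq) (hv' q hne)] at h
  simp at h

theorem MvPolynomial.continuous_eval_coeff {τ : Type*} (χ : Polynomial (MvPolynomial τ ℂ)) (i : ℕ) :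
    Continuous fun b : τ → ℂ => (χ.map (eval b)).coeff i := by
  simpa using MvPolynomial.continuous_eval (χ.coeff i)

/-- The points, outside of a proper subvariety, of an irreducible complex affine variety which is
finite over an affine space are dense in the Euclidean topology. -/
theorem MvPolynomial.exists_mem_nhds_eval_ne_zero_of_isIntegral {σ τ A : Type*} [Fintype σ]
    [CommRing A] [IsDomain A] [Algebra (MvPolynomial τ ℂ) A]
    [Module.IsTorsionFree (MvPolynomial τ ℂ) A] [Algebra.IsIntegral (MvPolynomial τ ℂ) A]
    (π : MvPolynomial σ ℂ →+* A) (hπ : Function.Surjective π)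
    (hC : ∀ c, π (C c) = algebraMap (MvPolynomial τ ℂ) A (C c))
    {p : σ → ℂ} (hp : ∀ f, π f = 0 → eval p f = 0)
    {g : MvPolynomial σ ℂ} (hg : π g ≠ 0) {U : Set (σ → ℂ)} (hU : U ∈ 𝓝 p) :
    ∃ q ∈ U, (∀ f, π f = 0 → eval q f = 0) ∧ eval q g ≠ 0 := by
  let S := MvPolynomial τ ℂ
  -- Lifts to polynomials of elements of `S`.
  choose lift hlift using fun x : S => hπ (algebraMap S A x)
  have hom : ∀ q : σ → ℂ, (∀ f, π f = 0 → eval q f = 0) →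
      ∃ φ : A →+* ℂ, (∀ f, φ (π f) = eval q f) ∧
        φ.comp (algebraMap S A) = eval fun j => eval q (lift (X j)) := by
    intro q hq
    have hφ : ∀ f, RingHom.liftOfSurjective π hπ ⟨eval q, hq⟩ (π f) = eval q f := fun f =>
      RingHom.liftOfRightInverse_comp_apply _ _ _ _ _
    refine ⟨_, hφ, MvPolynomial.ringHom_ext (fun c => ?_) fun j => ?_⟩
    · rw [RingHom.comp_apply, ← hC, hφ, eval_C, eval_C]
    · rw [RingHom.comp_apply, ← hlift, hφ, eval_X]
  have eval_minpoly : ∀ q : σ → ℂ, (∀ f, π f = 0 → eval q f = 0) → ∀ v : MvPolynomial σ ℂ,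
      ((minpoly S (π v)).map (eval fun j => eval q (lift (X j)))).eval (eval q v) = 0 := by
    intro q hq v
    obtain ⟨φ, hφ, hφS⟩ := hom q hq
    rw [Polynomial.eval_map, ← hφS, ← hφ, ← Polynomial.hom_eval₂, ← Polynomial.aeval_def,
      minpoly.aeval, map_zero]
  set a : τ → ℂ := fun j => eval p (lift (X j))
  let χ : σ → Polynomial S := fun i => minpoly S (π (X i))
  have hχ : ∀ i, (χ i).Monic := fun i => minpoly.monic (Algebra.IsIntegral.isIntegral _)
  let E : Set (σ → ℂ) := {q | (∀ f, π f = 0 → eval q f = 0) ∧ ∀ j, eval q (lift (X j)) = a j}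
  -- On the fibre over `a`, each coordinate is a root of a fixed monic polynomial.
  have hE : E.Finite := by
    refine (Set.Finite.pi' fun i => ((χ i).map (eval a)).roots.toFinset.finite_toSet).subset ?_
    rintro q ⟨hq, hqa⟩ i
    have h0 : ((χ i).map (eval a)).IsRoot (q i) := by
      have := eval_minpoly q hq (X i)
      rw [show (fun j => eval q (lift (X j))) = a from _root_.funext hqa] at this
      simpa using this
    simpa using ⟨((hχ i).map _).ne_zero, h0⟩
  obtain ⟨u, hup, huE⟩ := MvPolynomial.exists_eval_eq_zero_iff p hE
  let ψ : Polynomial S := minpoly S (π u)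
  have hψ : ψ.Monic := minpoly.monic (Algebra.IsIntegral.isIntegral _)
  have hψd : 0 < ψ.natDegree := minpoly.natDegree_pos (Algebra.IsIntegral.isIntegral _)
  have hψa : (ψ.map (eval a)).coeff 0 = 0 := by
    have := eval_minpoly p hp u
    rwa [hup, ← Polynomial.coeff_zero_eq_eval_zero] at this
  -- By integrality the nonzero ideal generated by `g` meets `S`; where `h` does not vanish, neither
  -- does `g`.
  obtain ⟨h, hh0, w, hw⟩ : ∃ h : S, h ≠ 0 ∧ ∃ w, algebraMap S A h = w * π g := by
    have hne := Ideal.comap_ne_bot_of_integral_mem (R := S) (I := Ideal.span {π g})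
      hg (Ideal.mem_span_singleton_self _) (Algebra.IsIntegral.isIntegral _)
    obtain ⟨h, hh, hh0⟩ := Submodule.exists_mem_ne_zero_of_ne_bot hne
    obtain ⟨w, hw⟩ := Ideal.mem_span_singleton'.1 hh
    exact ⟨h, hh0, w, hw.symm⟩
  obtain ⟨b, hb, hbh⟩ := MvPolynomial.exists_seq_tendsto_eval_ne_zero hh0 a
  -- Over `b n` there is a point at which `u` takes the smallest root of its specialised minimal
  -- polynomial. These roots tend to 0, because the constant coefficient vanishes at `a`.
  have hroot : ∀ n, ∃ q : σ → ℂ, (∀ f, π f = 0 → eval q f = 0) ∧ (∀ j, eval q (lift (X j)) = b n j) ∧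
      ‖eval q u‖ ^ ψ.natDegree ≤ ‖(ψ.map (eval (b n))).coeff 0‖ := by
    intro n
    obtain ⟨μ, hμ, hμn⟩ := (hψ.map (eval (b n))).exists_isRoot_norm_pow_le
      (by rwa [hψ.natDegree_map])
    rw [hψ.natDegree_map] at hμn
    obtain ⟨Q, hQ, hQG⟩ := exists_isMaximal_of_eval₂_minpoly_eq_zero (π u) (eval (b n))
      (fun c => ⟨C c, by simp⟩) μ (by rw [← Polynomial.eval_map]; exact hμ)
    have := Ideal.comap_isMaximal_of_surjective π hπ (K := Q)
    obtain ⟨q, hq⟩ := MvPolynomial.isMaximal_iff_eq_vanishingIdeal_singleton.1 this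
    have hqQ : ∀ f, π f ∈ Q → eval q f = 0 := fun f hf => by
      have : f ∈ Ideal.comap π Q := hf
      rw [hq, mem_vanishingIdeal_singleton_iff] at this
      rwa [← MvPolynomial.coe_aeval_eq_eval]
    refine ⟨q, fun f hf => hqQ f (hf ▸ Q.zero_mem), fun j => ?_, ?_⟩
    · have := hqQ (lift (X j) - C (b n j)) (by
        rw [map_sub, hlift, hC, ← map_sub, ← Polynomial.aeval_C (A := A) (π u)]
        exact hQG _ (by simp))
      rwa [map_sub, eval_C, sub_eq_zero] at this
    · have := hqQ (u - C μ) (by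
        rw [map_sub, hC]
        have := hQG (Polynomial.X - Polynomial.C (C μ)) (by simp)
        rwa [map_sub, Polynomial.aeval_X, Polynomial.aeval_C] at this)
      rw [map_sub, eval_C, sub_eq_zero] at this
      rwa [this]
  choose q hqP hqb hqu using hroot
  have hqu0 : Tendsto (fun n => eval (q n) u) atTop (𝓝 0) := by
    have h0 : Tendsto (fun n => ‖(ψ.map (eval (b n))).coeff 0‖) atTop (𝓝 0) := by
      simpa [hψa] using (((continuous_eval_coeff ψ 0).tendsto a).comp hb).norm
    have h1 := squeeze_zero (fun n => by positivity) hqu h0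
    have h2 : Tendsto (fun n => ((‖eval (q n) u‖ ^ ψ.natDegree) ^ ((ψ.natDegree : ℝ)⁻¹) : ℝ)) atTop
        (𝓝 0) := by
      have := h1.rpow_const (p := (ψ.natDegree : ℝ)⁻¹) (Or.inr (by positivity))
      rwa [Real.zero_rpow (by positivity)] at this
    simp only [Real.pow_rpow_inv_natCast (norm_nonneg _) hψd.ne'] at h2
    exact tendsto_zero_iff_norm_tendsto_zero.2 h2
  have hbdd : Bornology.IsBounded (Set.range q) := by
    rw [← Bornology.forall_isBounded_image_eval_iff]
    intro i
    have hlim : Tendsto (fun n => (∑ k ∈ Finset.range (χ i).natDegree,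
        ‖((χ i).map (eval (b n))).coeff k‖) + 1) atTop
        (𝓝 ((∑ k ∈ Finset.range (χ i).natDegree, ‖((χ i).map (eval a)).coeff k‖) + 1)) :=
      (tendsto_finsetSum _ fun k _ =>
        (((continuous_eval_coeff (χ i) k).tendsto a).comp hb).norm).add_const 1
    obtain ⟨M, hM⟩ := hlim.bddAbove_range
    refine (Metric.isBounded_closedBall (x := (0 : ℂ)) (r := M)).subset ?_
    rintro _ ⟨_, ⟨n, rfl⟩, rfl⟩
    rw [mem_closedBall_zero_iff]
    refine le_trans ?_ (hM ⟨n, rfl⟩)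
    have h0 := eval_minpoly (q n) (hqP n) (X i)
    rw [show (fun j => eval (q n) (lift (X j))) = b n from _root_.funext (hqb n), eval_X] at h0
    have := ((hχ i).map (eval (b n))).norm_le_of_isRoot h0
    rwa [(hχ i).natDegree_map] at this
  obtain ⟨q', -, φ, hφ, hq'⟩ := tendsto_subseq_of_bounded hbdd fun n => Set.mem_range_self n
  have hlim : ∀ f : MvPolynomial σ ℂ, Tendsto (fun n => eval (q (φ n)) f) atTop (𝓝 (eval q' f)) :=
    fun f => ((MvPolynomial.continuous_eval f).tendsto q').comp hq'
  -- The limit lies in the fibre over `a` and is a zero of `u`, which singles out `p` there.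
  have hq'p : q' = p := by
    refine huE q' ⟨fun f hf => ?_, fun j => ?_⟩ ?_
    · refine tendsto_nhds_unique (hlim f) ?_
      simp [hqP _ f hf]
    · refine tendsto_nhds_unique (hlim _) ?_
      simp only [hqb]
      exact ((tendsto_pi_nhds.1 hb) j).comp hφ.tendsto_atTop
    · exact tendsto_nhds_unique (hlim u) (hqu0.comp hφ.tendsto_atTop)
  obtain ⟨n, hn⟩ := (hq'.eventually (hq'p ▸ hU)).exists
  refine ⟨q (φ n), hn, hqP _, fun h0 => hbh (φ n) ?_⟩
  obtain ⟨w, rfl⟩ := hπ w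
  obtain ⟨f, hf, hfS⟩ := hom (q (φ n)) (hqP _)
  have := congrArg f hw
  rw [← RingHom.comp_apply, hfS, map_mul, hf, hf, h0, mul_zero, _root_.funext (hqb _)] at this
  exact this

/-- The points, outside of a proper subvariety, of an irreducible complex affine variety are dense
in the Euclidean topology. -/
theorem MvPolynomial.exists_mem_nhds_eval_ne_zero {σ : Type*} [Fintype σ]
    (P : Ideal (MvPolynomial σ ℂ)) [P.IsPrime] {p : σ → ℂ} (hp : ∀ f ∈ P, eval p f = 0)
    {g : MvPolynomial σ ℂ} (hg : g ∉ P) {U : Set (σ → ℂ)} (hU : U ∈ 𝓝 p) :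
    ∃ q ∈ U, (∀ f ∈ P, eval q f = 0) ∧ eval q g ≠ 0 := by
  obtain ⟨s, ι, hinj, hint⟩ := exists_integral_inj_algHom_of_fg ℂ (MvPolynomial σ ℂ ⧸ P)
  let A := MvPolynomial σ ℂ ⧸ P
  let : Algebra (MvPolynomial (Fin s) ℂ) A := ι.toRingHom.toAlgebra
  have : Algebra.IsIntegral (MvPolynomial (Fin s) ℂ) A := ⟨hint⟩
  have : FaithfulSMul (MvPolynomial (Fin s) ℂ) A :=
    (faithfulSMul_iff_algebraMap_injective _ _).2 hinj
  have hP : ∀ f, Ideal.Quotient.mk P f = 0 ↔ f ∈ P := fun f => Ideal.Quotient.eq_zero_iff_mem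
  have := exists_mem_nhds_eval_ne_zero_of_isIntegral (τ := Fin s) (A := A) (Ideal.Quotient.mk P)
    Ideal.Quotient.mk_surjective (fun c => (ι.commutes c).symm) (p := p) (g := g)
    (by simpa only [hP] using hp) (by simpa only [ne_eq, hP] using hg) hU
  simpa only [hP] using this

/-! ### Isolated points and Krull's height theorem -/

namespace MvPolynomial

/-- Translation of the variables by `c`. -/
def translate {σ : Type*} (c : σ → ℂ) : MvPolynomial σ ℂ ≃ₐ[ℂ] MvPolynomial σ ℂ :=
  AlgEquiv.ofAlgHom (aeval fun i => X i + C (c i)) (aeval fun i => X i - C (c i))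
    (algHom_ext fun i => by simp) (algHom_ext fun i => by simp)

theorem eval_translate {σ : Type*} (c x : σ → ℂ) (f : MvPolynomial σ ℂ) :
    eval x (translate c f) = eval (x + c) f := by
  have : (aeval x).comp (translate c : MvPolynomial σ ℂ →ₐ[ℂ] MvPolynomial σ ℂ) =
      aeval (R := ℂ) (x + c) := algHom_ext fun i => by simp [translate]
  exact DFunLike.congr_fun this f

/-- Some maximal ideal attains the Krull dimension, and translations carry any point to any other.
-/
theorem height_vanishingIdeal_singleton {σ : Type*} [Fintype σ] (p : σ → ℂ) :
    (vanishingIdeal ℂ {p}).height = Fintype.card σ := by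
  have hdim : ringKrullDim (MvPolynomial σ ℂ) = Fintype.card σ := by
    simp [MvPolynomial.ringKrullDim_of_isNoetherianRing]
  have : FiniteRingKrullDim (MvPolynomial σ ℂ) := by
    rw [finiteRingKrullDim_iff_ne_bot_and_top, hdim]
    exact ⟨WithBot.coe_ne_bot, fun h => ENat.natCast_ne_top _ (WithBot.coe_injective h)⟩
  obtain ⟨m, hm, hmh⟩ := Ideal.exists_isMaximal_height (R := MvPolynomial σ ℂ)
  obtain ⟨x, rfl⟩ := isMaximal_iff_eq_vanishingIdeal_singleton.1 hm
  have h := RingEquiv.height_comap (translate (x - p)).toRingEquiv (vanishingIdeal ℂ {p})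
  have hc : Ideal.comap (translate (x - p)).toRingEquiv (vanishingIdeal ℂ {p}) =
      vanishingIdeal ℂ {x} := by
    ext f
    have := eval_translate (x - p) p f
    rw [add_sub_cancel] at this
    simp only [Ideal.mem_comap, mem_vanishingIdeal_singleton_iff]
    exact Eq.congr_left this
  rw [← h, hc]
  rw [hdim] at hmh
  exact_mod_cast hmh

/-- If `p` is an isolated point of the intersection with `z = 0` of the zero set of fewer
polynomials than there are variables, then it is a limit of zeros with `z ≠ 0`. -/
theorem exists_eval_ne_zero_of_isIsolatedPointOf {σ : Type*} [Fintype σ]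
    {s : Set (MvPolynomial σ ℂ)} (hs : s.Finite) (hcard : s.ncard < Fintype.card σ)
    (z : MvPolynomial σ ℂ) {p : σ → ℂ}
    (hp : IsIsolatedPointOf p {q | (∀ f ∈ s, eval q f = 0) ∧ eval q z = 0})
    {U : Set (σ → ℂ)} (hU : U ∈ 𝓝 p) :
    ∃ q ∈ U, (∀ f ∈ s, eval q f = 0) ∧ eval q z ≠ 0 := by
  obtain ⟨⟨hps, hpz⟩, V, hV, hVp⟩ := hp
  have hmem : ∀ f, f ∈ vanishingIdeal ℂ {p} ↔ eval p f = 0 := fun f => by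
    rw [mem_vanishingIdeal_singleton_iff]
    rfl
  obtain ⟨P, hPmin, hPp⟩ := Ideal.exists_minimalPrimes_le (I := Ideal.span s)
    (J := vanishingIdeal ℂ {p}) (Ideal.span_le.2 fun f hf => (hmem f).2 (hps f hf))
  have : P.IsPrime := hPmin.1.1
  have hsP : ∀ f ∈ s, f ∈ P := fun f hf => hPmin.1.2 (Ideal.subset_span hf)
  have hlt : P < vanishingIdeal ℂ {p} := by
    refine lt_of_le_of_ne hPp ?_
    rintro rfl
    have := Ideal.height_le_card_of_mem_minimalPrimes_span hs hPmin
    rw [height_vanishingIdeal_singleton] at this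
    exact absurd hcard (not_lt.2 (by exact_mod_cast this))
  have hpP : ∀ f ∈ P, eval p f = 0 := fun f hf => (hmem f).1 (hPp hf)
  -- Otherwise the component of `P` lies in `z = 0`. Density, applied to some `g` that vanishes at
  -- `p` but not on the component, gives a second point of the slice in `V`.
  have hz : z ∉ P := by
    intro hz
    obtain ⟨g, hg, hgP⟩ := Set.exists_of_ssubset hlt
    obtain ⟨q, hq, hqP, hqg⟩ := exists_mem_nhds_eval_ne_zero P hpP hgP hV
    exact hqg (hVp q hq ⟨fun f hf => hqP f (hsP f hf), hqP z hz⟩ ▸ (hmem g).1 hg)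
  obtain ⟨q, hq, hqP, hqz⟩ := exists_mem_nhds_eval_ne_zero P hpP hz hU
  exact ⟨q, hq, fun f hf => hqP f (hsP f hf), hqz⟩

end MvPolynomial

/-! ### Counting edges -/

namespace IdealTriangulation

variable {N : ℕ} (T : IdealTriangulation N)

/-- The directed edge `x` with its direction reversed. -/
def reverse (x : VertexPair N) : VertexPair N := ⟨(x.1.1, x.1.2.2, x.1.2.1), x.2.symm⟩

theorem card_vertexPair : Fintype.card (VertexPair N) = 12 * N := by
  have e : VertexPair N ≃ Fin N × {y : Fin 4 × Fin 4 // y.1 ≠ y.2} :=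
    { toFun := fun x => (x.1.1, ⟨x.1.2, x.2⟩)
      invFun := fun x => ⟨(x.1, x.2.1), x.2.2⟩
      left_inv := fun _ => rfl
      right_inv := fun _ => rfl }
  rw [Fintype.card_congr e, Fintype.card_prod, Fintype.card_fin, mul_comm]
  congr 1

/-- If `g` is free of fixed points and preserves the fibres of the surjection `f` then there are at
most half as many fibres as points. -/
theorem two_mul_card_le_of_surjective {α β : Type*} [Finite α] (f : α → β)
    (hf : Function.Surjective f) (g : α → α) (hg : ∀ x, f (g x) = f x) (hne : ∀ x, g x ≠ x) :
    2 * Nat.card β ≤ Nat.card α := by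
  have : Finite β := Finite.of_surjective f hf
  let s := Function.surjInv hf
  have hs : ∀ b, f (s b) = b := Function.surjInv_eq hf
  have hinj : Function.Injective (Sum.elim s (g ∘ s)) := by
    rintro (a | a) (b | b) h
    · rw [Function.injective_surjInv hf h]
    · have : a = b := by rw [← hs a, ← hs b, ← hg (s b)]; exact congrArg f h
      subst this
      exact absurd h.symm (hne _)
    · have : a = b := by rw [← hs a, ← hs b, ← hg (s a)]; exact congrArg f h
      subst this
      exact absurd h (hne _)
    · have : a = b := by
        rw [← hs a, ← hs b, ← hg (s a), ← hg (s b)]; exact congrArg f h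
      rw [this]
  have := Nat.card_le_card_of_injective _ hinj
  rw [Nat.card_sum] at this
  omega

/-- The vertex `a` for which `v, w, a` and the remaining vertex are an even permutation of
`0, 1, 2, 3`. -/
def evenVertex (v w : Fin 4) : Fin 4 :=
  ![![0, 2, 3, 1], ![3, 1, 0, 2], ![1, 3, 2, 0], ![2, 0, 1, 3]] v w

theorem eq_evenVertex_or : ∀ {v w f : Fin 4}, v ≠ w → f ≠ v → f ≠ w →
    f = evenVertex v w ∨ f = evenVertex w v := by
  decide

/-- An odd permutation exchanges even and odd orderings, hence the roles of the two remaining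
vertices. -/
theorem evenVertex_perm : ∀ {g : Equiv.Perm (Fin 4)}, Equiv.Perm.sign g = -1 → ∀ {v w : Fin 4},
    v ≠ w → evenVertex (g v) (g w) = g (evenVertex w v) := by
  decide

theorem perm_evenVertex_of_swap : ∀ {g : Equiv.Perm (Fin 4)}, Equiv.Perm.sign g = -1 →
    ∀ {v w : Fin 4}, v ≠ w → g v = w → g w = v → g (evenVertex v w) = evenVertex v w := by
  decide

/-- The directed edge of the adjacent tetrahedron to which `x` is glued through the face `f`. -/
def pushEdge (x : VertexPair N) (f : Fin 4) : VertexPair N :=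
  ⟨(T.adj x.1.1 f, T.glue x.1.1 f x.1.2.1, T.glue x.1.1 f x.1.2.2),
    fun h => x.2 ((T.glue x.1.1 f).injective h)⟩

theorem pushEdge_pushEdge (x : VertexPair N) (f : Fin 4) :
    T.pushEdge (T.pushEdge x f) (T.glue x.1.1 f f) = x := by
  refine Subtype.ext (Prod.ext (T.adj_adj _ _) (Prod.ext ?_ ?_)) <;>
  simp [pushEdge, T.glue_glue]

/-- Rotation about an edge, in the positive sense with respect to its direction, from a tetrahedron
to the next one. -/
def rotate : Equiv.Perm (VertexPair N) where
  toFun x := T.pushEdge x (evenVertex x.1.2.1 x.1.2.2)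
  invFun x := T.pushEdge x (evenVertex x.1.2.2 x.1.2.1)
  left_inv x := by
    have : evenVertex (T.pushEdge x (evenVertex x.1.2.1 x.1.2.2)).1.2.2
        (T.pushEdge x (evenVertex x.1.2.1 x.1.2.2)).1.2.1 =
        T.glue x.1.1 (evenVertex x.1.2.1 x.1.2.2) (evenVertex x.1.2.1 x.1.2.2) :=
      evenVertex_perm (T.odd _ _) x.2.symm
    simp only [this, pushEdge_pushEdge]
  right_inv x := by
    have : evenVertex (T.pushEdge x (evenVertex x.1.2.2 x.1.2.1)).1.2.1
        (T.pushEdge x (evenVertex x.1.2.2 x.1.2.1)).1.2.2 =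
        T.glue x.1.1 (evenVertex x.1.2.2 x.1.2.1) (evenVertex x.1.2.2 x.1.2.1) :=
      evenVertex_perm (T.odd _ _) x.2
    simp only [this, pushEdge_pushEdge]

theorem rotate_reverse (x : VertexPair N) : T.rotate (reverse x) = reverse (T.rotate.symm x) := rfl

theorem rotate_zpow_reverse (x : VertexPair N) (k : ℤ) :
    (T.rotate ^ k) (reverse x) = reverse ((T.rotate ^ (-k)) x) := by
  induction k using Int.induction_on generalizing x with
  | zero => rfl
  | succ n ih =>
    rw [zpow_add_one, Equiv.Perm.mul_apply, rotate_reverse, ih, neg_add, zpow_add,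
      Equiv.Perm.mul_apply, zpow_neg_one]
    rfl
  | pred n ih =>
    have h : T.rotate⁻¹ (reverse x) = reverse (T.rotate x) := by
      rw [Equiv.Perm.inv_eq_iff_eq, rotate_reverse, Equiv.symm_apply_apply]
    rw [zpow_sub_one, Equiv.Perm.mul_apply, h, ih, neg_sub, sub_neg_eq_add, add_comm, neg_neg,
      zpow_add_one, Equiv.Perm.mul_apply]

/-- The gluing map would swap the ends of the edge; being odd, it would fix the other two vertices,
and a face would be glued to itself, against `free`. -/
theorem rotate_ne_reverse (x : VertexPair N) : T.rotate x ≠ reverse x := by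
  intro h
  have h1 : T.adj x.1.1 (evenVertex x.1.2.1 x.1.2.2) = x.1.1 := congrArg (fun y => y.1.1) h
  have h2 : T.glue x.1.1 (evenVertex x.1.2.1 x.1.2.2) x.1.2.1 = x.1.2.2 :=
    congrArg (fun y => y.1.2.1) h
  have h3 : T.glue x.1.1 (evenVertex x.1.2.1 x.1.2.2) x.1.2.2 = x.1.2.1 :=
    congrArg (fun y => y.1.2.2) h
  exact T.free x.1.1 (evenVertex x.1.2.1 x.1.2.2)
    (Prod.ext h1 (perm_evenVertex_of_swap (T.odd _ _) x.2 h2 h3))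

theorem reverse_ne (x : VertexPair N) : reverse x ≠ x := fun h =>
  x.2 (congrArg (fun y : VertexPair N => y.1.2.2) h)

/-- Reversal conjugates rotation to its inverse, so it would act on the orbit of `x` as the
reflection `j ↦ k - j`. For even `k` this fixes a directed edge; for odd `k` it exchanges two
consecutive ones. Neither is possible. -/
theorem rotate_zpow_ne_reverse (x : VertexPair N) (k : ℤ) : (T.rotate ^ k) x ≠ reverse x := by
  intro h
  have key : ∀ j : ℤ, reverse ((T.rotate ^ j) x) = (T.rotate ^ (k - j)) x := fun j => by
    have := T.rotate_zpow_reverse x (-j)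
    rw [neg_neg] at this
    rw [← this, ← h, ← Equiv.Perm.mul_apply, ← zpow_add, neg_add_eq_sub]
  obtain ⟨j, rfl | rfl⟩ := Int.even_or_odd' k
  · refine reverse_ne ((T.rotate ^ j) x) ((key j).trans ?_)
    rw [two_mul, add_sub_cancel_right]
  · refine T.rotate_ne_reverse ((T.rotate ^ j) x) (Eq.symm ((key j).trans ?_))
    rw [show 2 * j + 1 - j = 1 + j by ring, zpow_one_add, Equiv.Perm.mul_apply]

/-- Only two faces of a tetrahedron contain a given edge, so a gluing step is a rotation or its
inverse. -/
theorem exists_zpow_rotate_of_directedEdgeSetoid {x y : VertexPair N}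
    (h : T.directedEdgeSetoid x y) : ∃ k : ℤ, (T.rotate ^ k) x = y := by
  have h' : Relation.EqvGen T.EdgeStep x y := h
  induction h' with
  | rel x y hxy =>
    obtain ⟨f, hv, hw, hy⟩ := hxy
    obtain rfl | rfl := eq_evenVertex_or x.2 hv hw
    · exact ⟨1, Subtype.ext hy.symm⟩
    · exact ⟨-1, by rw [zpow_neg_one]; exact Subtype.ext hy.symm⟩
  | refl x => exact ⟨0, rfl⟩
  | symm x y hxy ih =>
    obtain ⟨k, rfl⟩ := ih hxy
    exact ⟨-k, by rw [← Equiv.Perm.mul_apply, ← zpow_add, neg_add_cancel, zpow_zero]; rfl⟩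
  | trans x y z hxy hyz ih ih' =>
    obtain ⟨k, rfl⟩ := ih hxy
    obtain ⟨m, rfl⟩ := ih' hyz
    exact ⟨m + k, by rw [zpow_add, Equiv.Perm.mul_apply]⟩

/-- Reversal acts on the classes of directed edges without fixed points: no edge is identified with
its own reverse. -/
theorem two_mul_card_edge_le : 2 * Nat.card T.Edge ≤ Nat.card (Quotient T.directedEdgeSetoid) := by
  have hle : ∀ x y, T.directedEdgeSetoid x y → T.edgeSetoid x y := fun x y h =>
    Relation.EqvGen.mono (fun _ _ => Or.inl) x y h
  have hrev : ∀ x y, T.directedEdgeSetoid x y →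
      T.directedEdgeSetoid (reverse x) (reverse y) := fun x y h => by
    have h' : Relation.EqvGen T.EdgeStep x y := h
    induction h' with
    | rel x y hxy =>
      obtain ⟨f, hv, hw, hy⟩ := hxy
      refine Relation.EqvGen.rel _ _ ⟨f, hw, hv, ?_⟩
      simp only [reverse, hy]
    | refl x => exact Relation.EqvGen.refl _
    | symm x y hxy ih => exact T.directedEdgeSetoid.symm' (ih hxy)
    | trans x y z hxy hyz ih ih' => exact T.directedEdgeSetoid.trans' (ih hxy) (ih' hyz)
  refine two_mul_card_le_of_surjective (Quotient.map' id hle) ?_ (Quotient.map' reverse hrev) ?_ ?_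
  · rintro ⟨x⟩
    exact ⟨Quotient.mk _ x, rfl⟩
  · rintro ⟨x⟩
    exact Quotient.sound (Relation.EqvGen.rel _ _ (Or.inr rfl))
  · rintro ⟨x⟩ h
    obtain ⟨k, hk⟩ := T.exists_zpow_rotate_of_directedEdgeSetoid (Quotient.exact h)
    have := T.rotate_zpow_ne_reverse (reverse x) k
    exact this hk

theorem two_mul_card_linkSide_le : 2 * Nat.card (Quotient T.linkSideSetoid) ≤ 12 * N := by
  rw [← card_vertexPair, ← Nat.card_eq_fintype_card]
  refine two_mul_card_le_of_surjective (Quotient.mk T.linkSideSetoid) Quotient.mk_surjective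
    (fun x => T.pushEdge x x.1.2.2) (fun x => ?_) fun x h => ?_
  · exact Quotient.sound (Relation.EqvGen.symm _ _ (Relation.EqvGen.rel _ _ rfl))
  · exact T.free x.1.1 x.1.2.2 (Prod.ext (congrArg (fun y => y.1.1) h)
      (congrArg (fun y => y.1.2.2) h))

/-- If the boundary is a single torus then there are at most as many edges as tetrahedra. -/
theorem HasTorusBoundary.card_edge_le (hT : T.HasTorusBoundary) : Nat.card T.Edge ≤ N := by
  obtain ⟨c, hc, hχ⟩ := hT
  have h1 := T.two_mul_card_edge_le
  have h2 := T.two_mul_card_linkSide_le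
  have hcard : ∀ s : Setoid (VertexPair N),
      ((Quotient.mk s) '' {x | T.startVertex x = c}).ncard = Nat.card (Quotient s) := by
    intro s
    rw [show {x | T.startVertex x = c} = Set.univ from Set.eq_univ_of_forall fun x => hc _,
      Set.image_univ, Quotient.mk_surjective.range_eq, Set.ncard_univ]
  have h3 : {x : Fin N × Fin 4 | Quotient.mk T.vertexSetoid x = c}.ncard = N * 4 := by
    rw [Set.eq_univ_of_forall (s := {x | Quotient.mk T.vertexSetoid x = c}) fun x => hc _,
      Set.ncard_univ]
    simp
  -- Vertices minus sides plus `4 * N` is 0, with at least `2 * |Edge|` vertices and at most `6 * N`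
  -- sides.
  rw [linkEulerChar, hcard, hcard, h3] at hχ
  omega

end IdealTriangulation

/-! Redundancy of the tilde equations -/

namespace IdealTriangulation

variable {N : ℕ} (T : IdealTriangulation N)

/-- The edges partition the six edges of every tetrahedron, two for each angle. -/
theorem prod_edgeMembers [Fintype T.Edge] {R : Type*} [CommMonoid R] (f : Fin N → Fin 3 → R) :
    ∏ e : T.Edge, ∏ x ∈ T.edgeMembers e, f x.1.1 (dihedralIndex x.1.2.1 x.1.2.2) =
      ∏ t, (∏ j, f t j) ^ 2 := by
  classical
  let F : Fin N × Fin 4 × Fin 4 → R := fun y =>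
    if y.2.1 < y.2.2 then f y.1 (dihedralIndex y.2.1 y.2.2) else 1
  have h1 : ∀ e : T.Edge, ∏ x ∈ T.edgeMembers e, f x.1.1 (dihedralIndex x.1.2.1 x.1.2.2) =
      ∏ x : VertexPair N with Quotient.mk T.edgeSetoid x = e, F x.1 := by
    intro e
    rw [← Finset.prod_filter (fun x : VertexPair N => x.1.2.1 < x.1.2.2), Finset.filter_filter]
    exact Finset.prod_congr (by ext; simp [edgeMembers, and_comm]) fun _ _ => rfl
  rw [Finset.prod_congr rfl fun e _ => h1 e, Finset.prod_fiberwise,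
    ← Finset.prod_subtype (Finset.univ.filter fun y : Fin N × Fin 4 × Fin 4 => y.2.1 ≠ y.2.2)
      (by simp) F, Finset.prod_filter, Fintype.prod_prod_type]
  refine Finset.prod_congr rfl fun t _ => ?_
  rw [Fintype.prod_prod_type]
  simp only [Fin.prod_univ_four, Fin.prod_univ_three, F]
  simp [dihedralIndex]
  rw [sq]
  ac_rfl

end IdealTriangulation

/-- Telescoping: `A i` and `B i` agree modulo `z ^ m * J`, hence so do their products. -/
theorem exists_prod_sub_prod_eq_mul {R ι : Type*} [CommRing R] (z : R) (A B g : ι → R)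
    (k : ι → ℕ) (m : ℕ) (h : ∀ i, A i - B i = z ^ k i * g i) (J : Ideal R) (s : Finset ι)
    (hs : ∀ i ∈ s, m ≤ k i ∧ g i ∈ J) :
    ∃ j ∈ J, ∏ i ∈ s, A i - ∏ i ∈ s, B i = z ^ m * j := by
  classical
  induction s using Finset.induction_on with
  | empty => exact ⟨0, J.zero_mem, by simp⟩
  | insert a s ha ih =>
    obtain ⟨j, hj, hjs⟩ := ih fun i hi => hs i (Finset.mem_insert_of_mem hi)
    obtain ⟨hm, hg⟩ := hs a (Finset.mem_insert_self a s)
    refine ⟨z ^ (k a - m) * (∏ i ∈ s, A i) * g a + B a * j,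
      J.add_mem (J.mul_mem_left _ hg) (J.mul_mem_left _ hj), ?_⟩
    rw [Finset.prod_insert ha, Finset.prod_insert ha]
    have h1 := h a
    rw [← Nat.add_sub_cancel' hm, pow_add] at h1
    linear_combination (∏ i ∈ s, A i) * h1 + B a * hjs

/-- Take `i₀` with the least exponent, so that `z ^ k i₀` divides the differences of all the other
factors and can be cancelled. -/
theorem exists_mul_prod_mem_span {R ι : Type*} [CommRing R] [IsDomain R] [Fintype ι] [Nonempty ι]
    [DecidableEq ι] {z : R} (hz : z ≠ 0) (A B g : ι → R) (k : ι → ℕ)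
    (h : ∀ i, A i - B i = z ^ k i * g i) (hAB : ∏ i, A i = ∏ i, B i) :
    ∃ i₀, g i₀ * ∏ i ∈ Finset.univ.erase i₀, A i ∈ Ideal.span (g '' {i₀}ᶜ) := by
  obtain ⟨i₀, -, hmin⟩ := Finset.univ.exists_min_image k Finset.univ_nonempty
  refine ⟨i₀, ?_⟩
  obtain ⟨j, hj, hjs⟩ := exists_prod_sub_prod_eq_mul z A B g k (k i₀) h (Ideal.span (g '' {i₀}ᶜ))
    (Finset.univ.erase i₀) fun i hi => ⟨hmin i (Finset.mem_univ i),
      Ideal.subset_span ⟨i, Finset.ne_of_mem_erase hi, rfl⟩⟩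
  rw [← Finset.mul_prod_erase _ _ (Finset.mem_univ i₀),
    ← Finset.mul_prod_erase _ B (Finset.mem_univ i₀)] at hAB
  have : g i₀ * ∏ i ∈ Finset.univ.erase i₀, A i = -B i₀ * j := by
    apply mul_left_cancel₀ (pow_ne_zero (k i₀) hz)
    linear_combination hAB - (∏ i ∈ Finset.univ.erase i₀, A i) * h i₀ - B i₀ * hjs
  rw [this]
  exact Ideal.mul_mem_left _ _ hj

namespace Degeneration

open MvPolynomial

variable {N : ℕ} (D : Degeneration N) (l : Fin N → Fin 3)

/-- If `a ≠ b`, dividing by the lower power of `ζ` leaves, at `ζ = 0`, only `A` or `-B`, which does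
not vanish at `p`. -/
theorem exists_eq_pow_mul_of_eval_removeZeta_eq_zero {p : Option (Fin N) → ℂ} (hp : p none = 0)
    {A B : MvPolynomial (Option (Fin N)) ℂ} {a b : ℕ} (hA : eval p A ≠ 0) (hB : eval p B ≠ 0)
    (h : eval p (removeZeta (X none ^ a * A - X none ^ b * B)) = 0) :
    a = b ∧ ∃ k, A - B = X none ^ k * removeZeta (X none ^ a * A - X none ^ b * B) := by
  have hX : (X none : MvPolynomial (Option (Fin N)) ℂ) ≠ 0 := X_ne_zero none
  set P := X none ^ a * A - X none ^ b * B with hP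
  set g := removeZeta P with hg
  set μ := multiplicity (X none) P
  have hμ : X none ^ μ * g = P := pow_mul_removeZeta P
  -- Any power of `ζ` that divides `P` is at most the one that is divided out.
  have hle : P ≠ 0 → ∀ c G, P = X none ^ c * G → c ≤ μ := by
    intro hP0 c G hG
    by_contra! hlt
    refine not_dvd_removeZeta hP0 ⟨X none ^ (c - μ - 1) * G, ?_⟩
    apply mul_left_cancel₀ (pow_ne_zero μ hX)
    rw [hμ, hG, ← mul_assoc, ← mul_assoc, ← pow_succ, ← pow_add]
    congr 2
    omega
  have hquot : ∀ c G, P = X none ^ c * G → ∃ k, G = X none ^ k * g := by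
    intro c G hG
    by_cases hP0 : P = 0
    · rw [hP0] at hG hμ
      rw [(mul_eq_zero.1 hμ).resolve_left (pow_ne_zero μ hX),
        (mul_eq_zero.1 hG.symm).resolve_left (pow_ne_zero c hX)]
      exact ⟨0, by simp⟩
    · refine ⟨μ - c, mul_left_cancel₀ (pow_ne_zero c hX) ?_⟩
      rw [← hG, ← mul_assoc, ← pow_add, Nat.add_sub_cancel' (hle hP0 c G hG), hμ]
  obtain hab | rfl | hab := lt_trichotomy a b
  · obtain ⟨c, rfl⟩ := Nat.exists_eq_add_of_lt hab
    obtain ⟨k, hk⟩ := hquot a (A - X none ^ (c + 1) * B) (by rw [hP]; ring)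
    have := congrArg (eval p) hk
    simp [hp, h] at this
    exact absurd this hA
  · exact ⟨rfl, hquot a (A - B) (by rw [hP]; ring)⟩
  · obtain ⟨c, rfl⟩ := Nat.exists_eq_add_of_lt hab
    obtain ⟨k, hk⟩ := hquot b (X none ^ (c + 1) * A - B) (by rw [hP]; ring)
    have := congrArg (eval p) hk
    simp [hp, h] at this
    exact absurd this hB

variable {D}

/-- `G` is a power of `ζ` times a polynomial that does not vanish at `p`. -/
def IsZetaPowMul (p : Option (Fin N) → ℂ) (G : MvPolynomial (Option (Fin N)) ℂ) : Prop :=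
  ∃ a A, G = X none ^ a * A ∧ eval p A ≠ 0

theorem IsZetaPowMul.of_eval_ne_zero {p : Option (Fin N) → ℂ}
    {G : MvPolynomial (Option (Fin N)) ℂ} (h : eval p G ≠ 0) : IsZetaPowMul p G :=
  ⟨0, G, by simp, h⟩

theorem IsZetaPowMul.prod {ι : Type*} {p : Option (Fin N) → ℂ} (s : Finset ι)
    {G : ι → MvPolynomial (Option (Fin N)) ℂ} (h : ∀ i ∈ s, IsZetaPowMul p (G i)) :
    IsZetaPowMul p (∏ i ∈ s, G i) := by
  refine Finset.prod_induction _ _ ?_ (.of_eval_ne_zero (by simp)) h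
  rintro _ _ ⟨a, A, rfl, hA⟩ ⟨b, B, rfl, hB⟩
  exact ⟨a + b, A * B, by ring, by simp [hA, hB]⟩

theorem isZetaPowMul_baseValue {p : Option (Fin N) → ℂ} (hnd : D.Nondegenerate p) (t : Fin N) :
    IsZetaPowMul p (D.baseValue t) := by
  unfold baseValue
  split
  · exact .of_eval_ne_zero (by simpa using (hnd t).1)
  · exact ⟨_, _, rfl, by simpa using (hnd t).1⟩

theorem eval_baseValue_ne_one {p : Option (Fin N) → ℂ} (hp : p none = 0) (hnd : D.Nondegenerate p)
    (t : Fin N) : eval p (D.baseValue t) ≠ 1 := by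
  unfold baseValue
  split
  · next h => simpa using (hnd t).2 h
  · simp [hp]

theorem isZetaPowMul_angleNum {p : Option (Fin N) → ℂ} (hp : p none = 0) (hnd : D.Nondegenerate p)
    (t : Fin N) (j : Fin 3) : IsZetaPowMul p (D.angleNum l t j) := by
  unfold angleNum
  split_ifs
  · exact isZetaPowMul_baseValue hnd t
  · exact .of_eval_ne_zero (by simpa [sub_eq_zero] using eval_baseValue_ne_one hp hnd t)
  · exact .of_eval_ne_zero (by simp)

theorem isZetaPowMul_angleDen {p : Option (Fin N) → ℂ} (hp : p none = 0) (hnd : D.Nondegenerate p)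
    (t : Fin N) (j : Fin 3) : IsZetaPowMul p (D.angleDen l t j) := by
  unfold angleDen
  split_ifs
  · exact .of_eval_ne_zero (by simp)
  · exact isZetaPowMul_baseValue hnd t
  · exact .of_eval_ne_zero (by simpa [sub_eq_zero] using (eval_baseValue_ne_one hp hnd t).symm)

variable (D) in
-- The product of the angles is -1; squaring removes the sign.
theorem prod_angleNum_sq (t : Fin N) :
    (∏ j, D.angleNum l t j) ^ 2 = (∏ j, D.angleDen l t j) ^ 2 := by
  unfold angleNum angleDen
  generalize D.baseAngle l t = i
  fin_cases i <;> simp [Fin.prod_univ_three] <;> ring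

/-- One of the tilde equations follows, near a solution with `ζ = 0`, from the other ones. -/
theorem exists_tildePoly_mul_mem_span (T : IdealTriangulation N) [Nonempty T.Edge]
    {p : Option (Fin N) → ℂ} (hp : p none = 0) (hnd : D.Nondegenerate p)
    (h : ∀ e, eval p (D.tildePoly l T e) = 0) :
    ∃ e₀ W, eval p W ≠ 0 ∧ D.tildePoly l T e₀ * W ∈ Ideal.span (D.tildePoly l T '' {e₀}ᶜ) := by
  classical
  let := Fintype.ofFinite T.Edge
  have hX : (X none : MvPolynomial (Option (Fin N)) ℂ) ≠ 0 := X_ne_zero none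
  choose a A hA hA0 using fun e => IsZetaPowMul.prod (T.edgeMembers e) fun x _ =>
    isZetaPowMul_angleNum l hp hnd x.1.1 (IdealTriangulation.dihedralIndex x.1.2.1 x.1.2.2)
  choose b B hB hB0 using fun e => IsZetaPowMul.prod (T.edgeMembers e) fun x _ =>
    isZetaPowMul_angleDen l hp hnd x.1.1 (IdealTriangulation.dihedralIndex x.1.2.1 x.1.2.2)
  have htilde : ∀ e, D.tildePoly l T e = removeZeta (X none ^ a e * A e - X none ^ b e * B e) :=
    fun e => by rw [tildePoly, gluingPoly, hA, hB]
  have key := fun e => exists_eq_pow_mul_of_eval_removeZeta_eq_zero hp (hA0 e) (hB0 e)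
    (htilde e ▸ h e)
  choose hab k hk using key
  -- Since `a e = b e` for every `e`, the same power of `ζ` cancels on both sides.
  have hAB : ∏ e, A e = ∏ e, B e := by
    have h1 := T.prod_edgeMembers (D.angleNum l)
    rw [Finset.prod_congr rfl fun t _ => D.prod_angleNum_sq l t, ← T.prod_edgeMembers] at h1
    simp only [hA, hB, Finset.prod_mul_distrib, hab] at h1
    exact mul_left_cancel₀ (Finset.prod_ne_zero_iff.2 fun e _ => pow_ne_zero _ hX) h1
  obtain ⟨e₀, he₀⟩ := exists_mul_prod_mem_span hX A B (D.tildePoly l T) k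
    (fun e => by rw [htilde, hk]) hAB
  refine ⟨e₀, _, ?_, he₀⟩
  rw [map_prod]
  exact Finset.prod_ne_zero_iff.2 fun e _ => hA0 e

end Degeneration

/-! Convergence to the ideal point -/

/-- The logarithms of the absolute values of the dihedral angles. -/
def logVector {N : ℕ} (z : Fin N → Fin 3 → ℂ) : EuclideanSpace ℝ (Fin N × Fin 3) :=
  WithLp.toLp 2 fun x => Real.log ‖z x.1 x.2‖

theorem logPoint_eq {N : ℕ} (z : Fin N → Fin 3 → ℂ) :
    logPoint z = (Real.sqrt (1 + ‖logVector z‖ ^ 2))⁻¹ • logVector z := by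
  ext x
  simp [logPoint, logVector, EuclideanSpace.norm_sq_eq, div_eq_inv_mul]

/-- Hence the image never contains its limit on the sphere, as an accumulation point requires. -/
theorem norm_logPoint_lt_one {N : ℕ} (z : Fin N → Fin 3 → ℂ) : ‖logPoint z‖ < 1 := by
  have h : 0 < Real.sqrt (1 + ‖logVector z‖ ^ 2) := Real.sqrt_pos.2 (by positivity)
  rw [logPoint_eq, norm_smul, norm_inv, Real.norm_of_nonneg h.le, inv_mul_lt_iff₀ h, mul_one]
  exact Real.lt_sqrt_of_sq_lt (by linarith)

/-- Rescaling by `L` turns the 1 under the root into `L⁻²`, which disappears in the limit. -/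
theorem tendsto_logPoint {N : ℕ} {z : ℕ → Fin N → Fin 3 → ℂ} {L : ℕ → ℝ}
    (hL : Tendsto L atTop atTop) {v : EuclideanSpace ℝ (Fin N × Fin 3)} (hv : v ≠ 0)
    (h : Tendsto (fun n => (L n)⁻¹ • logVector (z n)) atTop (𝓝 v)) :
    Tendsto (fun n => logPoint (z n)) atTop (𝓝 (‖v‖⁻¹ • v)) := by
  have h1 : Tendsto (fun n => (Real.sqrt ((L n)⁻¹ ^ 2 + ‖(L n)⁻¹ • logVector (z n)‖ ^ 2))⁻¹ •
      ((L n)⁻¹ • logVector (z n))) atTop (𝓝 (‖v‖⁻¹ • v)) := by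
    refine Tendsto.smul (Tendsto.inv₀ ?_ (norm_ne_zero_iff.2 hv)) h
    have := ((hL.inv_tendsto_atTop.pow 2).add (h.norm.pow 2)).sqrt
    simpa using this
  refine h1.congr' ?_
  filter_upwards [hL.eventually_gt_atTop 0] with n hn
  rw [logPoint_eq, norm_smul, mul_pow, Real.norm_of_nonneg (inv_nonneg.2 hn.le), smul_smul,
    ← mul_one_add, Real.sqrt_mul (by positivity), Real.sqrt_sq (inv_nonneg.2 hn.le), mul_inv,
    mul_right_comm, inv_mul_cancel₀ (inv_ne_zero hn.ne'), one_mul]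

namespace Degeneration

open MvPolynomial

variable {N : ℕ} (D : Degeneration N) (l : Fin N → Fin 3)

theorem angles_eq (q : Option (Fin N) → ℂ) (t : Fin N) (j : Fin 3) :
    D.angles l q t j = if j = D.baseAngle l t then eval q (D.baseValue t)
      else if j = D.baseAngle l t + 1 then (eval q (D.baseValue t) - 1) / eval q (D.baseValue t)
      else 1 / (1 - eval q (D.baseValue t)) := by
  unfold angles angleNum angleDen
  split_ifs <;> simp

/-- The rate at which `t` degenerates, `0` if it does not. -/
def rate (t : Fin N) : ℝ :=
  match D t with
  | none => 0
  | some (_, k) => (k : ℝ)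

theorem rateVector_apply (t : Fin N) (j : Fin 3) :
    D.rateVector (t, j) = if j = D.baseAngle l t then -D.rate t
      else if j = D.baseAngle l t + 1 then D.rate t else 0 := by
  unfold rateVector baseAngle rate
  cases h : D t <;> simp [h]

theorem rateVector_ne_zero (hD : ∃ t, D t ≠ none) : D.rateVector ≠ 0 := by
  obtain ⟨t, ht⟩ := hD
  obtain ⟨⟨i, k⟩, hik⟩ := Option.ne_none_iff_exists'.1 ht
  intro h
  have := congrArg (fun v => v (t, i)) h
  simp [rateVector, hik] at this

variable {D} in
theorem angles_mem_deformationVariety (T : IdealTriangulation N) {q : Option (Fin N) → ℂ}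
    (h0 : ∀ t, eval q (D.baseValue t) ≠ 0) (h1 : ∀ t, eval q (D.baseValue t) ≠ 1)
    (hq : ∀ e, eval q (D.tildePoly l T e) = 0) :
    D.angles l q ∈ T.deformationVariety := by
  have h1' : ∀ t, eval q (D.baseValue t) - 1 ≠ 0 := fun t => sub_ne_zero.2 (h1 t)
  have h1'' : ∀ t, 1 - eval q (D.baseValue t) ≠ 0 := fun t => sub_ne_zero.2 (h1 t).symm
  refine ⟨fun t j => ?_, fun t => ?_, fun e => ?_⟩
  · rw [angles_eq]
    have := h0 t
    have := h1 t
    have := h1' t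
    have := h1'' t
    split_ifs
    · exact ⟨h0 t, h1 t⟩
    · refine ⟨div_ne_zero (h1' t) (h0 t), ?_⟩
      rw [ne_eq, div_eq_one_iff_eq (h0 t), sub_eq_self]
      exact one_ne_zero
    · refine ⟨one_div_ne_zero (h1'' t), ?_⟩
      rw [ne_eq, div_eq_one_iff_eq (h1'' t), eq_comm, sub_eq_self]
      exact h0 t
  · simp only [angles_eq]
    have := h0 t
    have := h1'' t
    generalize D.baseAngle l t = i
    generalize eval q (D.baseValue t) = Z at *
    fin_cases i <;> simp <;> constructor <;> field_simp <;> ring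
  · have hden : ∀ t j, eval q (D.angleDen l t j) ≠ 0 := fun t j => by
      unfold angleDen
      split_ifs
      · simp
      · exact h0 t
      · simpa using h1'' t
    unfold angles
    rw [Finset.prod_div_distrib, div_eq_one_iff_eq (Finset.prod_ne_zero_iff.2 fun x _ => hden _ _)]
    -- The gluing polynomial is a multiple of the tilde polynomial, so it vanishes too.
    have h := congrArg (eval q) (pow_mul_removeZeta (D.gluingPoly l T e))
    rw [map_mul, show eval q (removeZeta (D.gluingPoly l T e)) = 0 from hq e, mul_zero,
      gluingPoly, map_sub, map_prod, map_prod] at h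
    exact sub_eq_zero.1 h.symm

theorem tendsto_log_norm_div {L : ℕ → ℝ} (hL : Tendsto L atTop atTop) {u : ℕ → ℂ} {c : ℂ}
    (hc : c ≠ 0) (hu : Tendsto u atTop (𝓝 c)) :
    Tendsto (fun n => (L n)⁻¹ * Real.log ‖u n‖) atTop (𝓝 0) := by
  simpa using hL.inv_tendsto_atTop.mul (hu.norm.log (norm_ne_zero_iff.2 hc))

variable {D} in
theorem tendsto_log_baseValue {p : Option (Fin N) → ℂ} (hnd : D.Nondegenerate p)
    {q : ℕ → Option (Fin N) → ℂ} (hq : Tendsto q atTop (𝓝 p)) (hq0 : ∀ n, q n none ≠ 0)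
    (hL : Tendsto (fun n => -Real.log ‖q n none‖) atTop atTop) (t : Fin N) :
    Tendsto (fun n => (-Real.log ‖q n none‖)⁻¹ * Real.log ‖eval (q n) (D.baseValue t)‖) atTop
      (𝓝 (-D.rate t)) := by
  have hy := tendsto_log_norm_div hL (hnd t).1 (tendsto_pi_nhds.1 hq (some t))
  unfold baseValue rate
  cases h : D t with
  | none => simpa using hy
  | some ik =>
    obtain ⟨i, k⟩ := ik
    have h1 := hy.const_add (-(k : ℝ))
    rw [add_zero] at h1
    refine h1.congr' ?_
    filter_upwards [hL.eventually_gt_atTop 0,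
      (tendsto_pi_nhds.1 hq (some t)).eventually_ne (hnd t).1] with n hn hyn
    have hζ := norm_ne_zero_iff.2 (hq0 n)
    simp only [map_mul, map_pow, eval_X, norm_mul, norm_pow]
    rw [Real.log_mul (pow_ne_zero _ hζ) (norm_ne_zero_iff.2 hyn), Real.log_pow]
    have : Real.log ‖q n none‖ ≠ 0 := by
      intro h0
      simp [h0] at hn
    field_simp
    ring

variable {D} in
theorem tendsto_logPoint_angles (hD : ∃ t, D t ≠ none) {p : Option (Fin N) → ℂ} (hp : p none = 0)
    (hnd : D.Nondegenerate p) {q : ℕ → Option (Fin N) → ℂ} (hq : Tendsto q atTop (𝓝 p))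
    (hq0 : ∀ n, q n none ≠ 0) (h0 : ∀ n t, eval (q n) (D.baseValue t) ≠ 0)
    (h1 : ∀ n t, eval (q n) (D.baseValue t) ≠ 1) :
    Tendsto (fun n => logPoint (D.angles l (q n))) atTop
      (𝓝 (‖D.rateVector‖⁻¹ • D.rateVector)) := by
  have hL : Tendsto (fun n => -Real.log ‖q n none‖) atTop atTop := by
    refine tendsto_neg_atBot_atTop.comp (Real.tendsto_log_nhdsNE_zero.comp ?_)
    refine tendsto_nhdsWithin_iff.2 ⟨?_, .of_forall fun n => norm_ne_zero_iff.2 (hq0 n)⟩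
    simpa [hp] using (tendsto_pi_nhds.1 hq none).norm
  refine tendsto_logPoint hL (D.rateVector_ne_zero hD) ?_
  have hcoord : Tendsto (fun n x => (-Real.log ‖q n none‖)⁻¹ * Real.log ‖D.angles l (q n) x.1 x.2‖)
      atTop (𝓝 (WithLp.ofLp D.rateVector)) := by
    refine tendsto_pi_nhds.2 fun x => ?_
    obtain ⟨t, j⟩ := x
    have hZ := tendsto_log_baseValue hnd hq hq0 hL t
    -- The limit of `Z - 1` is nonzero, so its logarithm stays bounded.
    have hZ1 : Tendsto (fun n => (-Real.log ‖q n none‖)⁻¹ *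
        Real.log ‖eval (q n) (D.baseValue t) - 1‖) atTop (𝓝 0) :=
      tendsto_log_norm_div hL (sub_ne_zero.2 (eval_baseValue_ne_one hp hnd t))
        ((((continuous_eval _).tendsto p).comp hq).sub_const 1)
    change Tendsto _ _ (𝓝 (D.rateVector (t, j)))
    rw [D.rateVector_apply l]
    simp only [angles_eq]
    split_ifs
    · exact hZ
    · have := hZ1.sub hZ
      rw [zero_sub, neg_neg] at this
      refine this.congr fun n => ?_
      rw [norm_div, Real.log_div (norm_ne_zero_iff.2 (sub_ne_zero.2 (h1 n t)))
        (norm_ne_zero_iff.2 (h0 n t)), mul_sub]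
    · have := hZ1.neg
      rw [neg_zero] at this
      refine this.congr fun n => ?_
      rw [norm_div, norm_one, one_div, Real.log_inv, mul_neg, norm_sub_rev]
  exact ((PiLp.continuous_toLp 2 _).tendsto _).comp hcoord

/-- The tilde equations and one further equation, satisfied at an isolated point of their solutions
with `ζ = 0`, have solutions with `ζ ≠ 0` nearby. -/
theorem exists_mem_tildeVariety_ne_zero (T : IdealTriangulation N) (hT : T.HasTorusBoundary)
    [Nonempty T.Edge] (F : MvPolynomial (Option (Fin N)) ℂ) {p : Option (Fin N) → ℂ}
    (hp : IsIsolatedPointOf p {q | q ∈ D.tildeVariety l T F ∧ q none = 0})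
    (hnd : D.Nondegenerate p) {U : Set (Option (Fin N) → ℂ)} (hU : U ∈ 𝓝 p) :
    ∃ q ∈ U, q ∈ D.tildeVariety l T F ∧ q none ≠ 0 := by
  obtain ⟨⟨⟨hpT, hpF⟩, hp0⟩, V, hV, hVp⟩ := hp
  obtain ⟨e₀, W, hW, hmem⟩ := exists_tildePoly_mul_mem_span l T hp0 hnd hpT
  have hWU : {q | eval q W ≠ 0} ∈ 𝓝 p := (continuous_eval W).continuousAt.eventually_ne hW
  -- With the redundant equation omitted, at most `N` polynomials remain; they suffice wherever `W ≠
  -- 0`.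
  let s := insert F (D.tildePoly l T '' {e₀}ᶜ)
  have hs : ∀ q, eval q W ≠ 0 → (∀ f ∈ s, eval q f = 0) → q ∈ D.tildeVariety l T F := by
    intro q hqW hq
    refine ⟨fun e => ?_, hq F (Set.mem_insert _ _)⟩
    by_cases he : e = e₀
    · subst he
      have hle : Ideal.span (D.tildePoly l T '' {e}ᶜ) ≤ RingHom.ker (eval q) :=
        Ideal.span_le.2 fun f hf => hq f (Set.mem_insert_of_mem _ hf)
      have := hle hmem
      rw [RingHom.mem_ker, map_mul] at this
      exact (mul_eq_zero.1 this).resolve_right hqW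
    · exact hq _ (Set.mem_insert_of_mem _ ⟨e, he, rfl⟩)
  have hcard : s.ncard < Fintype.card (Option (Fin N)) := by
    have h1 := Set.ncard_insert_le F (D.tildePoly l T '' {e₀}ᶜ)
    have h2 := Set.ncard_image_le (f := D.tildePoly l T) (Set.toFinite {e₀}ᶜ)
    have h3 := Set.ncard_add_ncard_compl {e₀}
    rw [Set.ncard_singleton] at h3
    have h4 := hT.card_edge_le
    rw [Fintype.card_option, Fintype.card_fin]
    change (insert F (D.tildePoly l T '' {e₀}ᶜ)).ncard < _
    omega
  have hps : ∀ f ∈ s, eval p f = 0 := by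
    rintro f (rfl | ⟨e, -, rfl⟩)
    exacts [hpF, hpT e]
  obtain ⟨q, ⟨hqU, hqW⟩, hqs, hqX⟩ := exists_eval_ne_zero_of_isIsolatedPointOf (Set.toFinite s)
    hcard (X none) (p := p) ⟨⟨hps, by simpa using hp0⟩, V ∩ {q | eval q W ≠ 0},
      inter_mem hV hWU, fun q hq hqs => hVp q hq.1 ⟨hs q hq.2 hqs.1, by simpa using hqs.2⟩⟩
    (inter_mem hU hWU)
  exact ⟨q, hqU, hs q hqW hqs, by simpa using hqX⟩

end Degeneration

end

/-! ### The ideal point as a limit -/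

theorem mainTheorem4 {N : ℕ} (T : IdealTriangulation N) (hT : T.HasTorusBoundary)
    (l : Fin N → Fin 3) (D : Degeneration N) (hD : ∃ t, D t ≠ none)
    (F : MvPolynomial (Option (Fin N)) ℂ) (p : Option (Fin N) → ℂ)
    (hp : IsIsolatedPointOf p {q | q ∈ D.tildeVariety l T F ∧ q none = 0})
    (hnd : D.Nondegenerate p) :
    IsIdealPoint T (‖D.rateVector‖⁻¹ • D.rateVector) ∧
    ∃ q : ℕ → Option (Fin N) → ℂ,
      (∀ n, q n ∈ D.tildeVariety l T F) ∧
      (∀ n, q n none ≠ 0) ∧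
      Tendsto q atTop (𝓝 p) ∧
      (∀ n, D.angles l (q n) ∈ T.deformationVariety) ∧
      Tendsto (fun n => logPoint (D.angles l (q n))) atTop
        (𝓝 (‖D.rateVector‖⁻¹ • D.rateVector)) := by
  have hN : Nonempty T.Edge := by
    obtain ⟨t, -⟩ := hD
    exact ⟨Quotient.mk _ ⟨(t, 0, 1), by simp⟩⟩
  have hp0 : p none = 0 := hp.1.2
  -- These conditions are open; together with `ζ ≠ 0` they keep every angle away from 0 and 1.
  have hgood : ∀ᶠ q in 𝓝 p, ∀ t, q (some t) ≠ 0 ∧ MvPolynomial.eval q (D.baseValue t) ≠ 1 :=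
    eventually_all.2 fun t => ((continuous_apply (some t)).continuousAt.eventually_ne (hnd t).1).and
      ((MvPolynomial.continuous_eval _).continuousAt.eventually_ne
        (Degeneration.eval_baseValue_ne_one hp0 hnd t))
  obtain ⟨B, hB⟩ := (𝓝 p).exists_antitone_basis
  choose q hqU hq hq0 using fun n => D.exists_mem_tildeVariety_ne_zero l T hT F hp hnd
    (inter_mem (hB.mem n) hgood)
  have hqp : Tendsto q atTop (𝓝 p) := hB.tendsto fun n => (hqU n).1
  have h0 : ∀ n t, MvPolynomial.eval (q n) (D.baseValue t) ≠ 0 := fun n t => by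
    have := ((hqU n).2 t).1
    have := hq0 n
    unfold Degeneration.baseValue
    split <;> simp [*]
  have h1 : ∀ n t, MvPolynomial.eval (q n) (D.baseValue t) ≠ 1 := fun n t => ((hqU n).2 t).2
  have hmem : ∀ n, D.angles l (q n) ∈ T.deformationVariety := fun n =>
    Degeneration.angles_mem_deformationVariety l T (h0 n) (h1 n) (hq n).1
  have hlim := Degeneration.tendsto_logPoint_angles l hD hp0 hnd hqp hq0 h0 h1
  have hnorm : ‖‖D.rateVector‖⁻¹ • D.rateVector‖ = 1 :=
    norm_smul_inv_norm (𝕜 := ℝ) (D.rateVector_ne_zero hD)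
  refine ⟨⟨mem_sphere_zero_iff_norm.2 hnorm, ?_⟩, q, hq, hq0, hqp, hmem, hlim⟩
  rw [accPt_iff_frequently]
  refine hlim.frequently (Frequently.of_forall fun n => ⟨fun h => ?_, _, hmem n, rfl⟩)
  have := norm_logPoint_lt_one (D.angles l (q n))
  rw [h, hnorm] at this
  exact lt_irrefl _ this
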